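/- Let $(X,b,m)$ be a finite weighted graph, that is, $X$ is a finite set, $b\colon X\times X\to[0,\infty)$ is symmetric and vanishes on the diagonal, and $m\colon X\to(0,\infty)$. Let $Lf(x)=\frac1{m(x)}\sum_{y}b(x,y)(f(x)-f(y))$ for $f\colon X\to\mathbb C$ be the graph Laplacian, $P_t=e^{-tL}$ ($t\ge 0$) the heat semigroup, $\partial f(x,y)=f(x)-f(y)$ the discrete gradient with values in the complex Hilbert space $\ell^2(X\times X,b/2)$ with inner product $\langle\xi,\eta\rangle_{b/2}=\frac12\sum_{x,y}b(x,y)\overline{\xi(x,y)}\eta(x,y)$, and let $$\mathcal J\xi(x,y)=-\overline{\xi(y,x)},\qquad \vec\Gamma(\xi)(x)=\frac1{2m(x)}\sum_{y\in X}b(x,y)|\xi(x,y)|^2,\qquad \Gamma(f)=\tfrac12\big(\overline{Lf}\,f+\overline f\,Lf-L(|f|^2)\big).$$ For $K\in\mathbb R$, the graph has intertwining curvature bounded below by $K$ if there is a strongly continuous semigroup $(\vec P_t)_{t\ge0}$ of linear operators on $\ell^2(X\times X,b/2)$ such that for all $t\ge 0$: (a) $\partial P_t=\vec P_t\partial$;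 (b) $\vec P_t\mathcal J=\mathcal J\vec P_t$; (c) $\vec\Gamma(\vec P_t\xi)\le e^{-2Kt}P_t\vec\Gamma(\xi)$ pointwise for all $\xi\in\ell^2(X\times X,b/2)$. An operator mean function is a continuous function $\Lambda\colon[0,\infty)\times[0,\infty)\to[0,\infty)$ for which there is a function $h\colon(0,\infty)\to(0,\infty)$ with $h(1)=1$ and $\Lambda(s,t)=s\,h(t/s)$ for all $s,t>0$ that is operator monotone, i.e. $h(A)\ge h(B)$ for all positive definite complex matrices $A\ge B$ of arbitrary size. The graph satisfies the gradient estimate $\mathrm{GE}_\Lambda(K,\infty)$ if $$\langle\partial P_tf,\Lambda\circ(\rho\otimes\rho)\,\partial P_tf\rangle_{b/2}\le e^{-2Kt}\langle\partial f,\Lambda\circ(P_t\rho\otimes P_t\rho)\,\partial f\rangle_{b/2}$$ for all $f\colon X\to\mathbb C$, $\rho\colon X\to[0,\infty)$ and $t\ge0$, where $(\rho\otimes\rho)(x,y)=(\rho(x),\rho(y))$. Theorem. If $(X,b,m)$ has intertwining curvature bounded below by $K$, then it satisfies $\mathrm{GE}_\Lambda(K,\infty)$ for every operator mean function $\Lambda$.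 In particular, it satisfies $\mathrm{GE}_\Lambda(K,\infty)$ for the arithmetic mean $\Lambda(s,t)=\frac{s+t}2$ as well as the Bakry–Émery curvature bound $K$ in the form $\Gamma(P_tf)\le e^{-2Kt}P_t\Gamma(f)$ for all $f\colon X\to\mathbb C$ and $t\ge0$, and it satisfies $\mathrm{GE}_\Lambda(K,\infty)$ for the logarithmic mean $\Lambda(s,t)=\frac{s-t}{\log s-\log t}$ (extended continuously to $[0,\infty)^2$), which is the gradient-estimate form of the Erbar–Maas entropic curvature bound $K$. -/

import Mathlib

open scoped ComplexOrder

/-- A finite weighted graph `(X, b, m)` on the finite vertex set `X`. -/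
structure FiniteWeightedGraph (X : Type*) where
  b : X → X → ℝ
  m : X → ℝ
  b_nonneg : ∀ x y, 0 ≤ b x y
  b_symm : ∀ x y, b x y = b y x
  b_diag : ∀ x, b x x = 0
  m_pos : ∀ x, 0 < m x

/-- `h : (0,∞) → (0,∞)` is operator monotone: `A ≥ B > 0` implies `h(A) ≥ h(B)` for complex
Hermitian matrices `A`, `B` of arbitrary size. Only the values of `h` on `(0,∞)` matter. -/
def OperatorMonotone (h : ℝ → ℝ) : Prop :=
  ∀ (n : ℕ) (A B : Matrix (Fin n) (Fin n) ℂ),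
    A.PosDef → B.PosDef → (A - B).PosSemidef → (cfc h A - cfc h B).PosSemidef

/-- `Λ : [0,∞) × [0,∞) → [0,∞)` is an operator mean function. Only the values of `Λ` on
`[0,∞) × [0,∞)` matter. -/
structure IsOperatorMean (Λ : ℝ → ℝ → ℝ) : Prop where
  nonneg : ∀ s t, 0 ≤ s → 0 ≤ t → 0 ≤ Λ s t
  continuousOn : ContinuousOn (fun p : ℝ × ℝ => Λ p.1 p.2) (Set.Ici 0 ×ˢ Set.Ici 0)
  exists_monotone : ∃ h : ℝ → ℝ, (∀ r, 0 < r → 0 < h r) ∧ OperatorMonotone h ∧ h 1 = 1 ∧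
    ∀ s t, 0 < s → 0 < t → Λ s t = s * h (t / s)

/-- The arithmetic mean. -/
noncomputable def arithmeticMean (s t : ℝ) : ℝ := (s + t) / 2

/-- The logarithmic mean `(s - t) / (log s - log t)`, continuously extended to `s = t` and to
`s = 0` or `t = 0`. -/
noncomputable def logarithmicMean (s t : ℝ) : ℝ :=
  if 0 < s ∧ 0 < t then
    if s = t then s else (s - t) / (Real.log s - Real.log t)
  else 0

/-- A strongly continuous one-parameter semigroup `(T_t)_{t ≥ 0}` of linear operators. It is used
for finite-dimensional `E`, where all linear operators are bounded and all norms are equivalent. -/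
structure IsStronglyContinuousSemigroup {E : Type*} [AddCommGroup E] [Module ℂ E]
    [TopologicalSpace E] (T : ℝ → E →ₗ[ℂ] E) : Prop where
  zero : T 0 = LinearMap.id
  add : ∀ s t, 0 ≤ s → 0 ≤ t → T (s + t) = T s ∘ₗ T t
  tendsto : ∀ ξ : E, Filter.Tendsto (fun t => T t ξ) (nhdsWithin 0 (Set.Ioi 0)) (nhds ξ)

namespace FiniteWeightedGraph

variable {X : Type*} (G : FiniteWeightedGraph X)

/-- The oriented edges, that is, the support of the measure `b / 2` on `X × X`. -/
abbrev Edge : Type _ := {p : X × X // 0 < G.b p.1 p.2}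

/-- The vector space underlying `ℓ²(X × X, b/2)`. Pairs with `b(x,y) = 0` are null sets, so an
element of `ℓ²(X × X, b/2)` is the same as a function on the support of `b`. -/
abbrev EdgeFun : Type _ := G.Edge → ℂ

/-- The edge `(y,x)` for the edge `(x,y)`. -/
def Edge.swap {G : FiniteWeightedGraph X} (e : G.Edge) : G.Edge :=
  ⟨(e.1.2, e.1.1), by rw [G.b_symm]; exact e.2⟩

/-- The discrete gradient `∂f(x,y) = f(x) - f(y)`. -/
def grad (f : X → ℂ) : G.EdgeFun := fun e => f e.1.1 - f e.1.2

/-- The conjugation `(𝒥ξ)(x,y) = - conj ξ(y,x)`. -/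
noncomputable def conjJ (ξ : G.EdgeFun) : G.EdgeFun := fun e => -star (ξ e.swap)

variable [Fintype X]

/-- The graph Laplacian `Lf(x) = m(x)⁻¹ ∑_y b(x,y) (f(x) - f(y))`. -/
noncomputable def laplacian : (X → ℂ) →L[ℂ] (X → ℂ) :=
  LinearMap.toContinuousLinearMap
    { toFun := fun f x => (1 / (G.m x : ℂ)) * ∑ y, (G.b x y : ℂ) * (f x - f y)
      map_add' := by
        intro f g
        funext x
        simp only [Pi.add_apply, ← mul_add, ← Finset.sum_add_distrib]
        congr 1
        exact Finset.sum_congr rfl fun y _ => by ring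
      map_smul' := by
        intro c f
        funext x
        simp only [Pi.smul_apply, smul_eq_mul, RingHom.id_apply, Finset.mul_sum]
        exact Finset.sum_congr rfl fun y _ => by ring }

/-- The heat semigroup `P_t = e^{-tL}`. -/
noncomputable def heat (t : ℝ) : (X → ℂ) →L[ℂ] (X → ℂ) :=
  NormedSpace.exp ((-t : ℂ) • G.laplacian)

open Classical in
/-- The inner product `⟨ξ, η⟩ = ½ ∑_{x,y} b(x,y) conj ξ(x,y) η(x,y)` of `ℓ²(X × X, b/2)`. -/
noncomputable def edgeInner (ξ η : G.EdgeFun) : ℂ :=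
  ∑ e : G.Edge, star (ξ e) * η e * ((G.b e.1.1 e.1.2 / 2 : ℝ) : ℂ)

/-- The carré du champ `Γ(f,g) = ½ (conj (Lf) g + conj f Lg - L(conj f g))`. -/
noncomputable def carreDuChamp (f g : X → ℂ) : X → ℂ :=
  (1 / 2 : ℂ) • (star (G.laplacian f) * g + star f * G.laplacian g - G.laplacian (star f * g))

open Classical in
/-- `Γ⃗(ξ,η)(x) = (2 m(x))⁻¹ ∑_y b(x,y) conj ξ(x,y) η(x,y)`. -/
noncomputable def vecGamma (ξ η : G.EdgeFun) : X → ℂ := fun x =>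
  (1 / (2 * G.m x) : ℂ) * ∑ y, if h : 0 < G.b x y then
    (G.b x y : ℂ) * star (ξ ⟨(x, y), h⟩) * η ⟨(x, y), h⟩ else 0

/-- The graph has intertwining curvature bounded below by `K`. In (c) both sides are real-valued,
and the inequality is pointwise. -/
def IntertwiningCurvatureBound (K : ℝ) : Prop :=
  ∃ V : ℝ → G.EdgeFun →ₗ[ℂ] G.EdgeFun,
    IsStronglyContinuousSemigroup V ∧
    (∀ t, 0 ≤ t → ∀ f : X → ℂ, G.grad (G.heat t f) = V t (G.grad f)) ∧
    (∀ t, 0 ≤ t → ∀ ξ : G.EdgeFun, V t (G.conjJ ξ) = G.conjJ (V t ξ)) ∧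
    (∀ t, 0 ≤ t → ∀ ξ : G.EdgeFun, ∀ x : X,
      G.vecGamma (V t ξ) (V t ξ) x ≤
        (Real.exp (-2 * K * t) : ℂ) * G.heat t (G.vecGamma ξ ξ) x)

/-- The form `⟨∂f, Λ∘(ρ⊗ρ) ∂f⟩` in `ℓ²(X × X, b/2)`, for `ρ : X → [0,∞)`. -/
noncomputable def weightedEnergy (Λ : ℝ → ℝ → ℝ) (ρ : X → ℝ) (f : X → ℂ) : ℂ :=
  G.edgeInner (G.grad f) (fun e => (Λ (ρ e.1.1) (ρ e.1.2) : ℂ) * G.grad f e)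

/-- The gradient estimate `GE_Λ(K,∞)`. For `ρ ≥ 0` the function `P_t ρ` is real and nonnegative,
so that taking the real part only changes its type. -/
def GradientEstimate (Λ : ℝ → ℝ → ℝ) (K : ℝ) : Prop :=
  ∀ (f : X → ℂ) (ρ : X → ℝ) (t : ℝ), (∀ x, 0 ≤ ρ x) → 0 ≤ t →
    G.weightedEnergy Λ ρ (G.heat t f) ≤
      (Real.exp (-2 * K * t) : ℂ) *
        G.weightedEnergy Λ (fun x => (G.heat t (fun y => (ρ y : ℂ)) x).re) f

/-- The Bakry–Émery curvature bound `K` in its exponential form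
`Γ(P_t f) ≤ e^{-2Kt} P_t Γ(f)`, pointwise on `X`. -/
def BakryEmeryBound (K : ℝ) : Prop :=
  ∀ (f : X → ℂ) (t : ℝ), 0 ≤ t → ∀ x : X,
    G.carreDuChamp (G.heat t f) (G.heat t f) x ≤
      (Real.exp (-2 * K * t) : ℂ) * G.heat t (G.carreDuChamp f f) x

end FiniteWeightedGraph

/-! Weighting (c) by `m ρ`, summing over vertices and moving `P_t` onto `ρ` by symmetry gives, for
the vector semigroup `V_t`, the form inequality `V_t* A V_t ≤ e^{-2Kt} A'`. Here `A` and `A'`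
multiply an edge function by `ρ(x)` and `P_tρ(x)`. Since `𝒥` exchanges the two endpoints of an edge
and commutes with `V_t`, the same holds for multiplication by `ρ(y)` and `P_tρ(y)`.

Kubo–Ando theory combines the two bounds: an operator mean is monotone in both arguments, satisfies
the transformer inequality `V*(A # B)V ≤ (V*AV) # (V*BV)`, and is homogeneous. All multiplication
operators here commute, so their mean is multiplication by `Λ(ρ(x), ρ(y))`. Evaluating at `∂f` and
using `∂P_t = V_t∂` gives the gradient estimate. The operator inequality is
`OperatorMonotone.mean_le`; it reduces to Hansen's inequality (`OperatorMonotone.contraction_conj`),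
proved by dilating a contraction to a unitary.

The Bakry–Émery bound is (c) at `ξ = ∂f`. The logarithmic mean is the integral over `θ ∈ (0,1)` of
the weighted geometric means, which are operator means by Löwner–Heinz, so its estimate follows by
integration. -/

/-! ### Matrix tools: functional calculus, Schur complements, defect operators -/

namespace Matrix

variable {n : Type*} [Fintype n] [DecidableEq n]

theorem aeval_unitary_conj_diagonal {U : Matrix n n ℂ} (hU : U * Uᴴ = 1) (hU' : Uᴴ * U = 1)
    (d : n → ℝ) (p : Polynomial ℝ) :
    Polynomial.aeval (Uᴴ * diagonal (fun i => (d i : ℂ)) * U) p =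
      Uᴴ * diagonal (fun i => ((p.eval (d i) : ℝ) : ℂ)) * U := by
  induction p using Polynomial.induction_on' with
  | add p q hp hq =>
    simp only [map_add, hp, hq, Polynomial.eval_add, Complex.ofReal_add, ← diagonal_add,
      Matrix.mul_add, Matrix.add_mul]
  | monomial k a =>
    have hpow : ∀ k : ℕ, (Uᴴ * diagonal (fun i => (d i : ℂ)) * U) ^ k =
        Uᴴ * diagonal (fun i => (d i : ℂ) ^ k) * U := by
      intro k
      induction k with
      | zero => simp [hU']
      | succ k ih =>
        rw [pow_succ, ih]
        calc Uᴴ * diagonal (fun i => (d i : ℂ) ^ k) * U *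
              (Uᴴ * diagonal (fun i => (d i : ℂ)) * U)
            = Uᴴ * diagonal (fun i => (d i : ℂ) ^ k) * (U * Uᴴ) *
              diagonal (fun i => (d i : ℂ)) * U := by simp only [Matrix.mul_assoc]
          _ = _ := by
            rw [hU, Matrix.mul_one, Matrix.mul_assoc Uᴴ, diagonal_mul_diagonal]
            simp only [pow_succ]
    have hdiag : diagonal (fun i => ((a * d i ^ k : ℝ) : ℂ)) =
        a • diagonal (fun i => (d i : ℂ) ^ k) := by
      ext i j
      by_cases h : i = j <;> simp [h]
    simp only [Polynomial.aeval_monomial, hpow, Polynomial.eval_monomial, hdiag]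
    simp [Algebra.algebraMap_eq_smul_one]

theorem isHermitian_conj_diagonal (U : Matrix n n ℂ) (d : n → ℝ) :
    (Uᴴ * diagonal (fun i => (d i : ℂ)) * U).IsHermitian := by
  refine isHermitian_conjTranspose_mul_mul U ?_
  rw [isHermitian_diagonal_iff]
  intro i
  simp [IsSelfAdjoint]

/-- The functional calculus of a unitarily diagonalized Hermitian matrix. -/
theorem cfc_unitary_conj_diagonal (h : ℝ → ℝ) {U : Matrix n n ℂ} (hU : U * Uᴴ = 1)
    (hU' : Uᴴ * U = 1) (d : n → ℝ) :
    cfc h (Uᴴ * diagonal (fun i => (d i : ℂ)) * U) =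
      Uᴴ * diagonal (fun i => ((h (d i) : ℝ) : ℂ)) * U := by
  set A := Uᴴ * diagonal (fun i => (d i : ℂ)) * U with hA
  -- Interpolating on the spectrum and on the values of `d` together avoids having to identify the
  -- two sets.
  have hfin : (spectrum ℝ A ∪ Set.range d).Finite :=
    (finite_real_spectrum).union (Set.finite_range d)
  set s := hfin.toFinset
  set p := Lagrange.interpolate s id h
  have hp : ∀ x ∈ s, p.eval x = h x := fun x hx =>
    Lagrange.eval_interpolate_at_node (v := id) h Function.injective_id.injOn hx
  have h1 : cfc h A = cfc p.eval A :=
    cfc_congr fun x hx => (hp x (hfin.mem_toFinset.2 (Or.inl hx))).symm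
  rw [h1, cfc_polynomial p A (isHermitian_conj_diagonal U d).isSelfAdjoint, hA,
    aeval_unitary_conj_diagonal hU hU']
  congr 3
  funext i
  rw [hp _ (hfin.mem_toFinset.2 (Or.inr ⟨i, rfl⟩))]

theorem exists_posSemidef_smul_one_sub {H : Matrix n n ℂ} (hH : H.IsHermitian) :
    ∃ r : ℝ, 0 < r ∧ ((r : ℂ) • (1 : Matrix n n ℂ) - H).PosSemidef := by
  obtain ⟨r, hr⟩ : ∃ r : ℝ, ∀ i, hH.eigenvalues i ≤ r := by
    obtain ⟨r, hr⟩ := (Set.finite_range hH.eigenvalues).bddAbove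
    exact ⟨r, fun i => hr ⟨i, rfl⟩⟩
  refine ⟨max r 1, by positivity, ?_⟩
  have hst := hH.spectral_theorem
  rw [Unitary.conjStarAlgAut_apply] at hst
  set U : Matrix n n ℂ := hH.eigenvectorUnitary.1
  have hU : U * star U = 1 := Unitary.coe_mul_star_self _
  have key : ((max r 1 : ℝ) : ℂ) • (1 : Matrix n n ℂ) - H =
      U * diagonal (fun i => ((max r 1 - hH.eigenvalues i : ℝ) : ℂ)) * Uᴴ := by
    have : diagonal (fun i => ((max r 1 - hH.eigenvalues i : ℝ) : ℂ)) =
        ((max r 1 : ℝ) : ℂ) • (1 : Matrix n n ℂ) -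
          diagonal (RCLike.ofReal ∘ hH.eigenvalues) := by
      ext i j
      by_cases h : i = j <;> simp [h]
    rw [this, Matrix.mul_sub, Matrix.sub_mul]
    conv_lhs => rw [hst]
    simp [← star_eq_conjTranspose, hU]
  rw [key]
  refine PosSemidef.mul_mul_conjTranspose_same (PosSemidef.diagonal fun i => ?_) _
  simpa using Or.inl (hr i)

/-- Both defects are Schur complements of the same block matrix with rows `(1, W)` and `(Wᴴ, 1)`,
one for each diagonal corner. -/
theorem PosSemidef.one_sub_mul_conjTranspose {W : Matrix n n ℂ}
    (hW : (1 - Wᴴ * W).PosSemidef) : (1 - W * Wᴴ).PosSemidef := by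
  have : Invertible (1 : Matrix n n ℂ) := invertibleOne
  have h1 := (PosDef.fromBlocks₁₁ W (1 : Matrix n n ℂ) PosDef.one).2 (by simpa using hW)
  have h2 := (PosDef.fromBlocks₂₂ (1 : Matrix n n ℂ) W PosDef.one).1 h1
  simpa using h2

theorem PosSemidef.spectrum_le_one {A : Matrix n n ℂ}
    (h : (1 - A).PosSemidef) {x : ℝ} (hx : x ∈ spectrum ℝ A) : x ≤ 1 := by
  have h1 := (posSemidef_iff_isHermitian_and_spectrum_nonneg (𝕜 := ℂ)).1 h
  have h2 : ((1 - x : ℝ) : ℂ) ∈ spectrum ℂ (1 - A) := by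
    have h3 : (x : ℂ) ∈ spectrum ℂ A := (spectrum.algebraMap_mem_iff ℂ).2 hx
    rw [spectrum.mem_iff] at h3 ⊢
    intro h4
    refine h3 ?_
    convert h4.neg using 1
    simp only [Complex.ofReal_sub, Complex.ofReal_one, map_sub, map_one]
    abel
  have := h1.2 h2
  simp only [Set.mem_ofPred_eq, Complex.zero_le_real] at this
  linarith

/-- Square roots of the defect operators of a contraction, intertwined by the contraction. -/
theorem exists_defect {W : Matrix n n ℂ} (hW : (1 - Wᴴ * W).PosSemidef) :
    ∃ D₁ D₂ : Matrix n n ℂ, D₁ᴴ = D₁ ∧ D₂ᴴ = D₂ ∧ D₁ * D₁ = 1 - Wᴴ * W ∧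
      D₂ * D₂ = 1 - W * Wᴴ ∧ W * D₁ = D₂ * W := by
  have hA : (Wᴴ * W).IsHermitian := isHermitian_conjTranspose_mul_self W
  have hB : (W * Wᴴ).IsHermitian := isHermitian_mul_conjTranspose_self W
  -- A single polynomial interpolates `√(1 - x)` on both spectra, so that both roots are values of
  -- the same `p`.
  have hfin : (spectrum ℝ (Wᴴ * W) ∪ spectrum ℝ (W * Wᴴ)).Finite :=
    finite_real_spectrum.union finite_real_spectrum
  set s := hfin.toFinset
  set p := Lagrange.interpolate s id (fun x => √(1 - x))
  have hp : ∀ x ∈ s, p.eval x = √(1 - x) := fun x hx =>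
    Lagrange.eval_interpolate_at_node (v := id) (fun x => √(1 - x))
      Function.injective_id.injOn hx
  have hsq : ∀ A : Matrix n n ℂ, A.IsHermitian → (1 - A).PosSemidef →
      (∀ x ∈ spectrum ℝ A, x ∈ s) →
      (Polynomial.aeval A p)ᴴ = Polynomial.aeval A p ∧
        Polynomial.aeval A p * Polynomial.aeval A p = 1 - A := by
    intro A hA h1 hs
    constructor
    · rw [← cfc_polynomial p A hA.isSelfAdjoint]
      exact cfc_predicate (R := ℝ) (p := IsSelfAdjoint) p.eval A
    · rw [← map_mul, ← cfc_polynomial (p * p) A hA.isSelfAdjoint]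
      have : cfc (p * p).eval A = cfc (1 - Polynomial.X : Polynomial ℝ).eval A := by
        refine cfc_congr fun x hx => ?_
        simp only [Polynomial.eval_mul, hp x (hs x hx), Polynomial.eval_sub, Polynomial.eval_one,
          Polynomial.eval_X]
        exact Real.mul_self_sqrt (by linarith [PosSemidef.spectrum_le_one h1 hx])
      rw [this, cfc_polynomial _ A hA.isSelfAdjoint]
      simp
  obtain ⟨h1, h2⟩ := hsq _ hA hW fun x hx => hfin.mem_toFinset.2 (Or.inl hx)
  obtain ⟨h3, h4⟩ := hsq _ hB hW.one_sub_mul_conjTranspose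
    fun x hx => hfin.mem_toFinset.2 (Or.inr hx)
  refine ⟨_, _, h1, h3, h2, h4, ?_⟩
  have hcomm : ∀ k : ℕ, W * (Wᴴ * W) ^ k = (W * Wᴴ) ^ k * W := by
    intro k
    induction k with
    | zero => simp
    | succ k ih => rw [pow_succ, ← Matrix.mul_assoc, ih, pow_succ]; simp only [Matrix.mul_assoc]
  -- The intertwining relation `W q(WᴴW) = q(WWᴴ) W` holds for every polynomial `q`.
  generalize p = q
  induction q using Polynomial.induction_on' with
  | add p q hp hq => simp only [map_add, Matrix.mul_add, Matrix.add_mul, hp, hq]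
  | monomial k a =>
    simp only [Polynomial.aeval_monomial, Algebra.algebraMap_eq_smul_one, smul_mul_assoc, one_mul,
      Matrix.mul_smul, hcomm]

end Matrix

/-! ### Hansen's inequality and the transformer inequality -/

section OperatorMonotone

open Matrix

variable {n : Type*} [Fintype n] [DecidableEq n]

/-- Reindexing by `Fin` makes operator monotonicity available on the index type `n ⊕ n` of the
dilation. -/
theorem OperatorMonotone.unitary_conj {h : ℝ → ℝ} (hh : OperatorMonotone h)
    {U : Matrix n n ℂ} (hU : U * Uᴴ = 1) (hU' : Uᴴ * U = 1) {d d' : n → ℝ}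
    (hd : ∀ i, 0 < d i) (hd' : ∀ i, 0 < d' i)
    (hle : (diagonal (fun i => (d' i : ℂ)) -
      Uᴴ * diagonal (fun i => (d i : ℂ)) * U).PosSemidef) :
    (diagonal (fun i => ((h (d' i) : ℝ) : ℂ)) -
      Uᴴ * diagonal (fun i => ((h (d i) : ℝ) : ℂ)) * U).PosSemidef := by
  set e := (Fintype.equivFin n).symm
  set V := U.submatrix e e with hV
  have hVV : V * Vᴴ = 1 := by
    rw [hV, conjTranspose_submatrix, submatrix_mul_equiv, hU, submatrix_one_equiv]
  have hVV' : Vᴴ * V = 1 := by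
    rw [hV, conjTranspose_submatrix, submatrix_mul_equiv, hU', submatrix_one_equiv]
  have hsub : ∀ c c' : n → ℝ, (diagonal (fun i => (c' i : ℂ)) -
      Uᴴ * diagonal (fun i => (c i : ℂ)) * U).submatrix e e =
      diagonal (fun i => ((c' (e i) : ℝ) : ℂ)) -
        Vᴴ * diagonal (fun i => ((c (e i) : ℝ) : ℂ)) * V := by
    intro c c'
    rw [submatrix_sub, Pi.sub_apply, Pi.sub_apply, ← submatrix_mul_equiv _ _ _ e,
      ← submatrix_mul_equiv _ _ _ e, submatrix_diagonal_equiv, submatrix_diagonal_equiv]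
    rfl
  have hpos : ∀ c : n → ℝ, (∀ i, 0 < c i) →
      (diagonal (fun i => ((c (e i) : ℝ) : ℂ))).PosDef := fun c hc =>
    PosDef.diagonal fun i => by simpa using hc (e i)
  have hinj : Function.Injective V.mulVec := by
    intro x y hxy
    have := congrArg (Vᴴ *ᵥ ·) hxy
    simpa [mulVec_mulVec, hVV'] using this
  have := hh _ (diagonal (fun i => ((d' (e i) : ℝ) : ℂ)))
    (Vᴴ * diagonal (fun i => ((d (e i) : ℝ) : ℂ)) * V) (hpos d' hd')
    ((hpos d hd).conjTranspose_mul_mul_same hinj) (by rw [← hsub]; exact hle.submatrix e)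
  have h1 := cfc_unitary_conj_diagonal h (U := (1 : Matrix (Fin (Fintype.card n)) _ ℂ))
    (by simp) (by simp) (fun i => d' (e i))
  simp only [conjTranspose_one, Matrix.one_mul, Matrix.mul_one] at h1
  rw [h1, cfc_unitary_conj_diagonal h hVV hVV' (fun i => d (e i))] at this
  exact (posSemidef_submatrix_equiv e).1 ((hsub (h ∘ d) (h ∘ d')).symm ▸ this)

/-- Hansen's inequality for diagonal matrices, up to a shift. -/
theorem OperatorMonotone.contraction_conj_shift {h : ℝ → ℝ} (hh : OperatorMonotone h)
    (hpos : ∀ r, 0 < r → 0 < h r) {W : Matrix n n ℂ} (hW : (1 - Wᴴ * W).PosSemidef)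
    {c c' : n → ℝ} (hc : ∀ i, 0 < c i) (hc' : ∀ i, 0 < c' i)
    (hle : (diagonal (fun i => (c' i : ℂ)) -
      Wᴴ * diagonal (fun i => (c i : ℂ)) * W).PosSemidef) {δ : ℝ} (hδ : 0 < δ) :
    (diagonal (fun i => ((h (c' i + 2 * δ) : ℝ) : ℂ)) -
      Wᴴ * diagonal (fun i => ((h (c i) : ℝ) : ℂ)) * W).PosSemidef := by
  obtain ⟨D₁, D₂, hD₁, hD₂, hD₁', hD₂', hWD⟩ := exists_defect hW
  have hWD' : D₁ * Wᴴ = Wᴴ * D₂ := by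
    have := congrArg conjTranspose hWD
    simpa [hD₁, hD₂] using this
  -- The Julia dilation: a unitary whose upper left corner is `W`.
  set U : Matrix (n ⊕ n) (n ⊕ n) ℂ := fromBlocks W D₂ D₁ (-Wᴴ) with hUdef
  have hUH : Uᴴ = fromBlocks Wᴴ D₁ D₂ (-W) := by
    simp [hUdef, fromBlocks_conjTranspose, hD₁, hD₂]
  have hU : Uᴴ * U = 1 := by
    rw [hUH, hUdef, fromBlocks_multiply, ← fromBlocks_one]
    simp [hD₁', hD₂', hWD, hWD']
  have hU' : U * Uᴴ = 1 := mul_eq_one_comm.1 hU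
  have hconj : ∀ x y : n → ℂ, Uᴴ * diagonal (Sum.elim x y) * U =
      fromBlocks (Wᴴ * diagonal x * W + D₁ * diagonal y * D₁)
        (Wᴴ * diagonal x * D₂ - D₁ * diagonal y * Wᴴ)
        (D₂ * diagonal x * W - W * diagonal y * D₁)
        (D₂ * diagonal x * D₂ + W * diagonal y * Wᴴ) := by
    intro x y
    rw [hUH, hUdef, ← fromBlocks_diagonal, fromBlocks_multiply, fromBlocks_multiply]
    simp [sub_eq_add_neg]
  set C : Matrix n n ℂ := diagonal (fun i => (c i : ℂ)) with hC
  have hCH : Cᴴ = C := by simp [hC, diagonal_conjTranspose, Pi.star_def]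
  set Δ : Matrix n n ℂ := diagonal (fun _ => (δ : ℂ)) with hΔ
  have hΔ1 : Δ = (δ : ℂ) • 1 := by rw [hΔ, smul_one_eq_diagonal]
  set N := -(Wᴴ * C * D₂ - D₁ * Δ * Wᴴ) with hN
  set M := D₂ * C * D₂ + W * Δ * Wᴴ with hM
  have hMH : M.IsHermitian := by
    simp only [IsHermitian, hM, hΔ1]
    simp [hD₂, hCH, Matrix.mul_assoc]
  have hΔpos : Δ.PosDef := PosDef.diagonal fun i => by simpa using hδ
  -- This `r` dominates `M + Nᴴ Δ⁻¹ N`, which is what the Schur complement criterion requires for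
  -- `hblock`.
  obtain ⟨r, hr, hrM⟩ := exists_posSemidef_smul_one_sub
    (hMH.add (isHermitian_conjTranspose_mul_mul N hΔpos.inv.1))
  have hblock : (fromBlocks Δ N Nᴴ ((r : ℂ) • 1 - M)).PosSemidef := by
    have := hΔpos.isUnit.invertible
    rw [PosDef.fromBlocks₁₁ N _ hΔpos, sub_sub]
    exact hrM
  have hdiff : (fromBlocks (diagonal (fun i => (c' i : ℂ)) - Wᴴ * C * W +
      (δ : ℂ) • (Wᴴ * W)) 0 0 (0 : Matrix n n ℂ)).PosSemidef := by
    have h1 : (diagonal (fun i => (c' i : ℂ)) - Wᴴ * C * W + (δ : ℂ) • (Wᴴ * W)).PosSemidef :=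
      hle.add ((posSemidef_conjTranspose_mul_self W).smul (by simpa using hδ.le))
    refine .of_dotProduct_mulVec_nonneg ?_ fun x => ?_
    · exact IsHermitian.fromBlocks h1.1 (by simp) (by simp [IsHermitian])
    · have := h1.dotProduct_mulVec_nonneg (x ∘ Sum.inl)
      rw [fromBlocks_mulVec]
      simpa [dotProduct] using this
  -- Of the shift `2δ`, one `δ` is the corner `Δ` of `hblock` absorbing the off-diagonal block `N`;
  -- the other absorbs `δ D₁² = δ(1 - WᴴW)` and leaves the term `δ WᴴW` of `hdiff`.
  have hmono := hh.unitary_conj hU' hU (d := Sum.elim c fun _ => δ)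
    (d' := Sum.elim (fun i => c' i + 2 * δ) fun _ => r) (by rintro (i | i) <;> simp [hc, hδ])
    (by rintro (i | i) <;> simp [hr]; have := hc' i; positivity) (by
      have e1 : (fun i => ((Sum.elim c (fun _ => δ) i : ℝ) : ℂ)) =
          Sum.elim (fun i => (c i : ℂ)) (fun _ : n => (δ : ℂ)) := by
        funext i; cases i <;> rfl
      have e2 : (fun i => ((Sum.elim (fun i => c' i + 2 * δ) (fun _ => r) i : ℝ) : ℂ)) =
          Sum.elim (fun i => ((c' i + 2 * δ : ℝ) : ℂ)) (fun _ : n => (r : ℂ)) := by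
        funext i; cases i <;> rfl
      rw [e1, e2, hconj, ← hC, ← hΔ, ← fromBlocks_diagonal, sub_eq_add_neg, fromBlocks_neg, fromBlocks_add]
      convert hblock.add hdiff using 1
      rw [fromBlocks_add]
      have e3 : diagonal (fun i => ((c' i + 2 * δ : ℝ) : ℂ)) =
          diagonal (fun i => (c' i : ℂ)) + (2 : ℂ) • Δ := by
        ext i j
        by_cases hij : i = j <;> simp [hΔ, hij]
      congr 1
      · rw [e3, hΔ1]
        simp only [Matrix.mul_smul, Matrix.smul_mul, Matrix.mul_one, hD₁']
        module
      · simp [hN]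
      · simp [hN, hΔ1, hD₁, hD₂, hCH, Matrix.mul_assoc]
      · rw [add_zero, sub_eq_add_neg, smul_one_eq_diagonal])
  have e1 : (fun i => ((h (Sum.elim c (fun _ => δ) i) : ℝ) : ℂ)) =
      Sum.elim (fun i => (h (c i) : ℂ)) (fun _ : n => (h δ : ℂ)) := by
    funext i; cases i <;> rfl
  -- The upper left corner contains the surplus `D₁ h(δ) D₁ ≥ 0`, which can be dropped since `h >
  -- 0`.
  have hcorner := hmono.submatrix Sum.inl
  rw [e1, hconj] at hcorner
  have h2 : (D₁ * diagonal (fun _ => (h δ : ℂ)) * D₁).PosSemidef := by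
    have : (diagonal (fun _ : n => (h δ : ℂ))).PosSemidef :=
      PosSemidef.diagonal fun i => by simpa using (hpos δ hδ).le
    simpa [hD₁] using this.conjTranspose_mul_mul_same D₁
  convert hcorner.add h2 using 1
  ext i j
  simp [diagonal_apply]
  ring

/-- This translates between the Löwner order and the weighted sums over edges. -/
theorem Matrix.posSemidef_diagonal_sub_iff {V : Matrix n n ℂ} {d d' : n → ℝ} :
    (diagonal (fun i => (d' i : ℂ)) - Vᴴ * diagonal (fun i => (d i : ℂ)) * V).PosSemidef ↔
      ∀ x : n → ℂ, ∑ i, d i * ‖(V *ᵥ x) i‖ ^ 2 ≤ ∑ i, d' i * ‖x i‖ ^ 2 := by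
  have hdiag : ∀ (c : n → ℝ) (x : n → ℂ), star x ⬝ᵥ (diagonal (fun i => (c i : ℂ)) *ᵥ x) =
      ((∑ i, c i * ‖x i‖ ^ 2 : ℝ) : ℂ) := by
    intro c x
    simp only [dotProduct, mulVec_diagonal, Complex.ofReal_sum, Complex.ofReal_mul,
      Complex.ofReal_pow, ← Complex.conj_mul']
    exact Finset.sum_congr rfl fun i _ => by simp; ring
  have hform : ∀ x : n → ℂ, star x ⬝ᵥ ((diagonal (fun i => (d' i : ℂ)) -
      Vᴴ * diagonal (fun i => (d i : ℂ)) * V) *ᵥ x) =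
      ((∑ i, d' i * ‖x i‖ ^ 2 - ∑ i, d i * ‖(V *ᵥ x) i‖ ^ 2 : ℝ) : ℂ) := by
    intro x
    rw [sub_mulVec, dotProduct_sub, hdiag, Complex.ofReal_sub, ← hdiag d, ← mulVec_mulVec,
      ← mulVec_mulVec, dotProduct_mulVec, ← star_mulVec]
  have hherm : (diagonal (fun i => (d' i : ℂ)) -
      Vᴴ * diagonal (fun i => (d i : ℂ)) * V).IsHermitian := by
    refine IsHermitian.sub ?_ (isHermitian_conj_diagonal V d)
    simpa using isHermitian_conj_diagonal (1 : Matrix n n ℂ) d'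
  constructor
  · intro h x
    have := h.dotProduct_mulVec_nonneg x
    rw [hform, Complex.zero_le_real] at this
    linarith
  · intro h
    refine .of_dotProduct_mulVec_nonneg hherm fun x => ?_
    rw [hform, Complex.zero_le_real]
    linarith [h x]

/-- Hansen's inequality for diagonal matrices. -/
theorem OperatorMonotone.contraction_conj {h : ℝ → ℝ} (hh : OperatorMonotone h)
    (hpos : ∀ r, 0 < r → 0 < h r) (hcont : ContinuousOn h (Set.Ioi 0)) {W : Matrix n n ℂ}
    (hW : ∀ x : n → ℂ, ∑ i, ‖(W *ᵥ x) i‖ ^ 2 ≤ ∑ i, ‖x i‖ ^ 2)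
    {c c' : n → ℝ} (hc : ∀ i, 0 < c i) (hc' : ∀ i, 0 < c' i)
    (hle : ∀ x : n → ℂ, ∑ i, c i * ‖(W *ᵥ x) i‖ ^ 2 ≤ ∑ i, c' i * ‖x i‖ ^ 2) (x : n → ℂ) :
    ∑ i, h (c i) * ‖(W *ᵥ x) i‖ ^ 2 ≤ ∑ i, h (c' i) * ‖x i‖ ^ 2 := by
  have hW' : (1 - Wᴴ * W).PosSemidef := by
    have := (posSemidef_diagonal_sub_iff (V := W) (d := fun _ => 1) (d' := fun _ => 1)).2
      (by simpa using hW)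
    simpa using this
  have hlim : Filter.Tendsto (fun δ : ℝ => ∑ i, h (c' i + 2 * δ) * ‖x i‖ ^ 2)
      (nhdsWithin 0 (Set.Ioi 0)) (nhds (∑ i, h (c' i) * ‖x i‖ ^ 2)) := by
    refine tendsto_finsetSum _ fun i _ => Filter.Tendsto.mul_const _ ?_
    have h1 : Filter.Tendsto h (nhds (c' i)) (nhds (h (c' i))) :=
      hcont.continuousAt (Ioi_mem_nhds (hc' i))
    refine h1.comp (Filter.Tendsto.mono_left ?_ nhdsWithin_le_nhds)
    have : Continuous fun δ : ℝ => c' i + 2 * δ := by fun_prop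
    simpa using this.tendsto 0
  refine ge_of_tendsto hlim (eventually_nhdsWithin_of_forall fun δ hδ => ?_)
  exact posSemidef_diagonal_sub_iff.1 (hh.contraction_conj_shift hpos hW' hc hc'
    (posSemidef_diagonal_sub_iff.2 hle) hδ) x

/-- Joint monotonicity and the transformer inequality for the operator mean represented by `h`,
in terms of weighted quadratic forms. -/
theorem OperatorMonotone.mean_le {h : ℝ → ℝ} (hh : OperatorMonotone h)
    (hpos : ∀ r, 0 < r → 0 < h r) (hcont : ContinuousOn h (Set.Ioi 0))
    (V : (n → ℂ) →ₗ[ℂ] (n → ℂ)) {w a b a' b' : n → ℝ} (hw : ∀ i, 0 < w i) (ha : ∀ i, 0 < a i)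
    (hb : ∀ i, 0 < b i) (ha' : ∀ i, 0 < a' i) (hb' : ∀ i, 0 < b' i)
    (hVa : ∀ x, ∑ i, w i * a i * ‖V x i‖ ^ 2 ≤ ∑ i, w i * a' i * ‖x i‖ ^ 2)
    (hVb : ∀ x, ∑ i, w i * b i * ‖V x i‖ ^ 2 ≤ ∑ i, w i * b' i * ‖x i‖ ^ 2) (x : n → ℂ) :
    ∑ i, w i * (a i * h (b i / a i)) * ‖V x i‖ ^ 2 ≤
      ∑ i, w i * (a' i * h (b' i / a' i)) * ‖x i‖ ^ 2 := by
  set S : n → ℝ := fun i => √(w i * a i)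
  set S' : n → ℝ := fun i => √(w i * a' i)
  have hS : ∀ i, S i ^ 2 = w i * a i := fun i => Real.sq_sqrt (mul_pos (hw i) (ha i)).le
  have hS' : ∀ i, S' i ^ 2 = w i * a' i := fun i => Real.sq_sqrt (mul_pos (hw i) (ha' i)).le
  have hS'0 : ∀ i, 0 < S' i := fun i => Real.sqrt_pos.2 (mul_pos (hw i) (ha' i))
  -- With `W = (wa)^{1/2} V (wa')^{-1/2}`, `hVa` says that `W` is a contraction and `hVb` that `Wᴴ
  -- (b/a) W ≤ b'/a'`; Hansen's inequality then applies to `h`.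
  set W : Matrix n n ℂ := diagonal (fun i => (S i : ℂ)) * LinearMap.toMatrix' V *
    diagonal (fun i => ((S' i)⁻¹ : ℂ))
  have hWx : ∀ (y : n → ℂ) (i : n), ‖(W *ᵥ fun i => (S' i : ℂ) * y i) i‖ ^ 2 =
      w i * a i * ‖V y i‖ ^ 2 := by
    intro y i
    have h1 : (diagonal fun i => ((S' i)⁻¹ : ℂ)) *ᵥ (fun i => (S' i : ℂ) * y i) = y := by
      funext j
      have : (S' j : ℂ) ≠ 0 := by exact_mod_cast (hS'0 j).ne'
      rw [mulVec_diagonal, inv_mul_cancel_left₀ this]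
    rw [← mulVec_mulVec, h1, ← mulVec_mulVec, LinearMap.toMatrix'_mulVec, mulVec_diagonal,
      norm_mul, mul_pow, Complex.norm_real, Real.norm_eq_abs, sq_abs, hS]
  have hx : ∀ y : n → ℂ, ∃ z : n → ℂ, y = fun i => (S' i : ℂ) * z i := by
    intro y
    refine ⟨fun i => (S' i : ℂ)⁻¹ * y i, funext fun i => ?_⟩
    have : (S' i : ℂ) ≠ 0 := by exact_mod_cast (hS'0 i).ne'
    rw [mul_inv_cancel_left₀ this]
  have hn : ∀ (y : n → ℂ) (i : n), ‖(S' i : ℂ) * y i‖ ^ 2 = w i * a' i * ‖y i‖ ^ 2 := by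
    intro y i
    rw [norm_mul, mul_pow, Complex.norm_real, Real.norm_eq_abs, sq_abs, hS']
  have key := hh.contraction_conj hpos hcont (W := W) (c := fun i => b i / a i)
    (c' := fun i => b' i / a' i) (by
      intro y
      obtain ⟨z, rfl⟩ := hx y
      simpa only [hWx, hn] using hVa z) (fun i => div_pos (hb i) (ha i))
    (fun i => div_pos (hb' i) (ha' i)) (by
      intro y
      obtain ⟨z, rfl⟩ := hx y
      simp only [hWx, hn]
      convert hVb z using 2 with i _ i _
      · have := (ha i).ne'
        field_simp
      · have := (ha' i).ne'
        field_simp) (fun i => (S' i : ℂ) * x i)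
  simp only [hWx, hn] at key
  convert key using 2 <;> ring

end OperatorMonotone

/-! ### The heat semigroup, edge sums and the two one-sided bounds -/

namespace FiniteWeightedGraph

variable {X : Type*} [Fintype X] (G : FiniteWeightedGraph X)

theorem laplacian_apply (f : X → ℂ) (x : X) :
    G.laplacian f x = (1 / (G.m x : ℂ)) * ∑ y, (G.b x y : ℂ) * (f x - f y) := rfl

theorem hasSum_exp_apply (A : (X → ℂ) →L[ℂ] (X → ℂ)) (f : X → ℂ) :
    HasSum (fun n : ℕ => ((n.factorial : ℂ)⁻¹) • (A ^ n) f) (NormedSpace.exp A f) :=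
  (NormedSpace.exp_series_hasSum_exp' (𝕂 := ℂ) A).mapL (ContinuousLinearMap.apply ℂ _ f)

theorem heat_const (t : ℝ) (c : ℂ) : G.heat t (fun _ => c) = fun _ => c := by
  have hL : ((-t : ℂ) • G.laplacian) (fun _ => c) = 0 := by
    funext x
    simp [laplacian_apply]
  have h := hasSum_exp_apply ((-t : ℂ) • G.laplacian) (fun _ => c)
  refine h.unique ?_
  convert hasSum_single (f := fun n : ℕ => ((n.factorial : ℂ)⁻¹) •
    (((-t : ℂ) • G.laplacian) ^ n) (fun _ : X => c)) 0 ?_ using 1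
  · simp
  · intro n hn
    obtain ⟨k, rfl⟩ := Nat.exists_eq_succ_of_ne_zero hn
    rw [Nat.succ_eq_add_one, pow_succ, mul_apply_eq_comp, hL, map_zero, smul_zero]

theorem sum_laplacian_mul (f g : X → ℂ) :
    ∑ x, (G.m x : ℂ) * G.laplacian f x * g x = ∑ x, (G.m x : ℂ) * f x * G.laplacian g x := by
  have h1 : ∀ f g : X → ℂ, ∀ x, (G.m x : ℂ) * G.laplacian f x * g x =
      ∑ y, (G.b x y : ℂ) * (f x * g x) - ∑ y, (G.b x y : ℂ) * (f y * g x) := by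
    intro f g x
    have hm : (G.m x : ℂ) ≠ 0 := by exact_mod_cast (G.m_pos x).ne'
    rw [laplacian_apply, ← mul_assoc, mul_one_div_cancel hm, one_mul, Finset.sum_mul,
      ← Finset.sum_sub_distrib]
    exact Finset.sum_congr rfl fun y _ => by ring
  have h2 : ∀ x, (G.m x : ℂ) * f x * G.laplacian g x = (G.m x : ℂ) * G.laplacian g x * f x :=
    fun x => by ring
  simp only [h2, h1, Finset.sum_sub_distrib]
  congr 1
  · exact Finset.sum_congr rfl fun x _ => Finset.sum_congr rfl fun y _ => by ring
  · rw [Finset.sum_comm]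
    exact Finset.sum_congr rfl fun x _ => Finset.sum_congr rfl fun y _ => by
      rw [G.b_symm]; ring

/-- The heat semigroup is symmetric with respect to the measure `m`. -/
theorem sum_heat_mul (t : ℝ) (f g : X → ℂ) :
    ∑ x, (G.m x : ℂ) * G.heat t f x * g x = ∑ x, (G.m x : ℂ) * f x * G.heat t g x := by
  set A := (-t : ℂ) • G.laplacian with hA
  have hsymm : ∀ f g : X → ℂ, ∑ x, (G.m x : ℂ) * A f x * g x = ∑ x, (G.m x : ℂ) * f x * A g x := by
    intro f g
    have := congrArg (fun z => (-t : ℂ) * z) (G.sum_laplacian_mul f g)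
    simp only [Finset.mul_sum] at this
    convert this using 2 with x _ x _ <;> simp [hA] <;> ring
  have hpow : ∀ (n : ℕ) (f g : X → ℂ),
      ∑ x, (G.m x : ℂ) * (A ^ n) f x * g x = ∑ x, (G.m x : ℂ) * f x * (A ^ n) g x := by
    intro n
    induction n with
    | zero => simp
    | succ n ih =>
      intro f g
      rw [pow_succ, mul_apply_eq_comp, ih, hsymm, ← mul_apply_eq_comp,
        ← pow_succ', pow_succ]
  have h1 : HasSum (fun n : ℕ => ∑ x, (G.m x : ℂ) * (((n.factorial : ℂ)⁻¹) • (A ^ n) f) x * g x)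
      (∑ x, (G.m x : ℂ) * G.heat t f x * g x) :=
    hasSum_sum fun x _ =>
      ((Pi.hasSum.1 (hasSum_exp_apply A f) x).mul_left (G.m x : ℂ)).mul_right (g x)
  have h2 : HasSum (fun n : ℕ => ∑ x, (G.m x : ℂ) * f x * (((n.factorial : ℂ)⁻¹) • (A ^ n) g) x)
      (∑ x, (G.m x : ℂ) * f x * G.heat t g x) :=
    hasSum_sum fun x _ => (Pi.hasSum.1 (hasSum_exp_apply A g) x).mul_left ((G.m x : ℂ) * f x)
  refine h1.unique ?_
  convert h2 using 2 with n
  have := congrArg (fun z => ((n.factorial : ℂ)⁻¹) * z) (hpow n f g)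
  simp only [Finset.mul_sum] at this
  convert this using 2 with x _ x _ <;> simp <;> ring

theorem exp_apply_nonneg {A : (X → ℂ) →L[ℂ] (X → ℂ)} (hA : ∀ f, 0 ≤ f → 0 ≤ A f) {f : X → ℂ}
    (hf : 0 ≤ f) : 0 ≤ NormedSpace.exp A f := by
  have hpow : ∀ n : ℕ, 0 ≤ (A ^ n) f := by
    intro n
    induction n with
    | zero => simpa using hf
    | succ n ih => rw [pow_succ', mul_apply_eq_comp]; exact hA _ ih
  intro x
  refine (Pi.hasSum.1 (hasSum_exp_apply A f) x).nonneg fun n => ?_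
  have h1 : (0 : ℂ) ≤ (n.factorial : ℂ)⁻¹ := by
    rw [show ((n.factorial : ℂ)⁻¹) = (((n.factorial : ℝ)⁻¹ : ℝ) : ℂ) by push_cast; rfl,
      Complex.zero_le_real]
    positivity
  exact mul_nonneg h1 (hpow n x)

/-- The heat semigroup preserves positivity. -/
theorem heat_nonneg {t : ℝ} (ht : 0 ≤ t) {f : X → ℂ} (hf : 0 ≤ f) : 0 ≤ G.heat t f := by
  -- Once `c` dominates the weighted degrees, `Q = tc - tL` has nonnegative entries, and `e^{-tL} =
  -- e^{-tc} e^Q`.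
  obtain ⟨c, hc⟩ : ∃ c : ℝ, ∀ x, (1 / G.m x) * ∑ y, G.b x y ≤ c := by
    obtain ⟨c, hc⟩ := (Set.finite_range fun x => (1 / G.m x) * ∑ y, G.b x y).bddAbove
    exact ⟨c, fun x => hc ⟨x, rfl⟩⟩
  set Q : (X → ℂ) →L[ℂ] (X → ℂ) := ((t * c : ℝ) : ℂ) • 1 + (-t : ℂ) • G.laplacian with hQ
  have hQpos : ∀ f, 0 ≤ f → 0 ≤ Q f := by
    intro f hf x
    have key : Q f x = (t : ℂ) * ((((c - (1 / G.m x) * ∑ y, G.b x y : ℝ) : ℂ)) * f x +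
        (((1 / G.m x : ℝ) : ℂ)) * ∑ y, (G.b x y : ℂ) * f y) := by
      simp only [hQ, add_apply, smul_apply,
        one_apply_eq_self, Pi.add_apply, Pi.smul_apply, smul_eq_mul, laplacian_apply,
        mul_sub, Finset.sum_sub_distrib, ← Finset.sum_mul]
      push_cast
      ring
    rw [key]
    have hsum : (0 : ℂ) ≤ ∑ y, (G.b x y : ℂ) * f y :=
      Finset.sum_nonneg fun y _ => mul_nonneg (by simpa using G.b_nonneg x y) (hf y)
    refine mul_nonneg (by simpa using ht) (add_nonneg (mul_nonneg ?_ (hf x)) (mul_nonneg ?_ hsum))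
    · rw [Complex.zero_le_real]
      linarith [hc x]
    · rw [Complex.zero_le_real]
      have := G.m_pos x
      positivity
  have hexp : G.heat t = ((Real.exp (-(t * c)) : ℝ) : ℂ) • NormedSpace.exp Q := by
    let _ : NormedAlgebra ℚ ((X → ℂ) →L[ℂ] (X → ℂ)) := NormedAlgebra.restrictScalars ℚ ℂ _
    have h1 : (-t : ℂ) • G.laplacian =
        algebraMap ℂ ((X → ℂ) →L[ℂ] (X → ℂ)) ((-(t * c) : ℝ) : ℂ) + Q := by
      rw [hQ, Algebra.algebraMap_eq_smul_one]
      push_cast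
      module
    rw [heat, h1, NormedSpace.exp_add_of_commute (Algebra.commute_algebraMap_left _ _),
      ← NormedSpace.algebraMap_exp_comm, ← Complex.exp_eq_exp_ℂ, Algebra.algebraMap_eq_smul_one,
      smul_mul_assoc, one_mul, Complex.ofReal_exp]
  rw [hexp]
  intro x
  exact mul_nonneg (by rw [Complex.zero_le_real]; positivity) (exp_apply_nonneg hQpos hf x)

theorem heat_ofReal_nonneg {t : ℝ} (ht : 0 ≤ t) {ρ : X → ℝ} (hρ : ∀ x, 0 ≤ ρ x) (x : X) :
    0 ≤ (G.heat t (fun y => (ρ y : ℂ)) x).re ∧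
      (((G.heat t (fun y => (ρ y : ℂ)) x).re : ℝ) : ℂ) = G.heat t (fun y => (ρ y : ℂ)) x := by
  have h := Complex.nonneg_iff.1 (G.heat_nonneg ht (f := fun y => (ρ y : ℂ))
    (fun y => by simpa using hρ y) x)
  exact ⟨h.1, Complex.ext rfl (by simpa using h.2)⟩

theorem heat_add_const (t : ℝ) (ρ : X → ℝ) (ε : ℝ) (x : X) :
    (G.heat t (fun y => ((ρ y + ε : ℝ) : ℂ)) x).re =
      (G.heat t (fun y => (ρ y : ℂ)) x).re + ε := by
  have : (fun y => ((ρ y + ε : ℝ) : ℂ)) = (fun y => (ρ y : ℂ)) + fun _ => (ε : ℂ) := by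
    funext y; simp
  rw [this, map_add, heat_const]
  simp

open Classical in
theorem sum_edge {M : Type*} [AddCommMonoid M] (F : G.Edge → M) :
    ∑ e : G.Edge, F e = ∑ x, ∑ y, if h : 0 < G.b x y then F ⟨(x, y), h⟩ else 0 := by
  rw [← Fintype.sum_prod_type' (f := fun x y => if h : 0 < G.b x y then F ⟨(x, y), h⟩ else 0)]
  have h1 := Finset.sum_subtype (Finset.univ.filter fun p : X × X => 0 < G.b p.1 p.2)
    (p := fun p : X × X => 0 < G.b p.1 p.2) (F := inferInstance) (by simp)
    (fun p : X × X => if h : 0 < G.b p.1 p.2 then F ⟨p, h⟩ else 0)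
  rw [Finset.sum_filter] at h1
  calc ∑ e : G.Edge, F e
      = ∑ a : {p : X × X // 0 < G.b p.1 p.2},
          if h : 0 < G.b a.1.1 a.1.2 then F ⟨a.1, h⟩ else 0 :=
        Finset.sum_congr rfl fun e _ => by rw [dif_pos e.2]
    _ = _ := h1.symm
    _ = _ := Finset.sum_congr rfl fun p _ => by
        by_cases h : 0 < G.b p.1 p.2 <;> simp [h]

open Classical in
theorem sum_edge_swap {M : Type*} [AddCommMonoid M] (F : G.Edge → M) :
    ∑ e : G.Edge, F e.swap = ∑ e : G.Edge, F e :=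
  Function.Bijective.sum_comp (Function.Involutive.bijective (f := Edge.swap) fun _ => rfl) F

open Classical in
theorem sum_vecGamma (φ : X → ℂ) (ξ : G.EdgeFun) :
    ∑ x, (G.m x : ℂ) * φ x * G.vecGamma ξ ξ x =
      ∑ e : G.Edge, ((G.b e.1.1 e.1.2 / 2 : ℝ) : ℂ) * φ e.1.1 * ((‖ξ e‖ ^ 2 : ℝ) : ℂ) := by
  rw [sum_edge]
  refine Finset.sum_congr rfl fun x _ => ?_
  have hm : (G.m x : ℂ) ≠ 0 := by exact_mod_cast (G.m_pos x).ne'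
  rw [vecGamma, ← mul_assoc, Finset.mul_sum]
  refine Finset.sum_congr rfl fun y _ => ?_
  by_cases h : 0 < G.b x y
  · simp only [dif_pos h]
    push_cast
    rw [← Complex.conj_mul']
    field_simp
    simp only [Complex.star_def]
    ring
  · simp [h]

open Classical in
theorem weightedEnergy_eq (Λ : ℝ → ℝ → ℝ) (ρ : X → ℝ) (f : X → ℂ) :
    G.weightedEnergy Λ ρ f = ((∑ e : G.Edge, G.b e.1.1 e.1.2 / 2 * Λ (ρ e.1.1) (ρ e.1.2) *
      ‖G.grad f e‖ ^ 2 : ℝ) : ℂ) := by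
  rw [weightedEnergy, edgeInner, Complex.ofReal_sum]
  refine Finset.sum_congr rfl fun e _ => ?_
  push_cast
  rw [← Complex.conj_mul']
  simp
  ring

open Classical in
theorem carreDuChamp_eq_vecGamma (f : X → ℂ) :
    G.carreDuChamp f f = G.vecGamma (G.grad f) (G.grad f) := by
  funext x
  have hm : (G.m x : ℂ) ≠ 0 := by exact_mod_cast (G.m_pos x).ne'
  have h1 : ∀ y, (if h : 0 < G.b x y then (G.b x y : ℂ) * star (G.grad f ⟨(x, y), h⟩) *
      G.grad f ⟨(x, y), h⟩ else 0) = (G.b x y : ℂ) * (star (f x) - star (f y)) * (f x - f y) := by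
    intro y
    by_cases h : 0 < G.b x y
    · simp [h, grad]
    · simp [le_antisymm (not_lt.1 h) (G.b_nonneg x y)]
  simp only [vecGamma, h1]
  simp only [carreDuChamp, Pi.smul_apply, Pi.sub_apply, Pi.add_apply, Pi.mul_apply,
    Pi.star_apply, laplacian_apply, star_mul', star_div₀, star_one, star_sum, star_sub,
    smul_eq_mul, Complex.star_def, Complex.conj_ofReal]
  simp only [mul_assoc, Finset.sum_mul, Finset.mul_sum, ← Finset.sum_add_distrib,
    ← Finset.sum_sub_distrib]
  refine Finset.sum_congr rfl fun y _ => ?_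
  field_simp
  ring

variable {G} {K : ℝ}

theorem IntertwiningCurvatureBound.bakryEmeryBound (hK : G.IntertwiningCurvatureBound K) :
    G.BakryEmeryBound K := by
  obtain ⟨V, -, hgrad, -, hV⟩ := hK
  intro f t ht x
  simpa only [carreDuChamp_eq_vecGamma, hgrad t ht] using hV t ht (G.grad f) x

open Classical in
-- Pair the pointwise bound with `m ρ ≥ 0` and use the symmetry of `P_t` to move it from `Γ⃗(ξ)`
-- onto `ρ`.
theorem sum_edge_left_le {t : ℝ} (ht : 0 ≤ t) {V : G.EdgeFun →ₗ[ℂ] G.EdgeFun}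
    (hV : ∀ ξ : G.EdgeFun, ∀ x : X, G.vecGamma (V ξ) (V ξ) x ≤
      (Real.exp (-2 * K * t) : ℂ) * G.heat t (G.vecGamma ξ ξ) x)
    {ρ : X → ℝ} (hρ : ∀ x, 0 ≤ ρ x) (ξ : G.EdgeFun) :
    ∑ e : G.Edge, G.b e.1.1 e.1.2 / 2 * ρ e.1.1 * ‖V ξ e‖ ^ 2 ≤
      ∑ e : G.Edge, G.b e.1.1 e.1.2 / 2 *
        (Real.exp (-2 * K * t) * (G.heat t (fun y => (ρ y : ℂ)) e.1.1).re) * ‖ξ e‖ ^ 2 := by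
  have h1 : ∑ x, (G.m x : ℂ) * (ρ x : ℂ) * G.vecGamma (V ξ) (V ξ) x ≤
      ∑ x, (G.m x : ℂ) * (ρ x : ℂ) *
        ((Real.exp (-2 * K * t) : ℂ) * G.heat t (G.vecGamma ξ ξ) x) :=
    Finset.sum_le_sum fun x _ => mul_le_mul_of_nonneg_left (hV ξ x)
      (mul_nonneg (by simpa using (G.m_pos x).le) (by simpa using hρ x))
  have h2 : ∑ x, (G.m x : ℂ) * (ρ x : ℂ) *
        ((Real.exp (-2 * K * t) : ℂ) * G.heat t (G.vecGamma ξ ξ) x) =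
      ∑ x, (G.m x : ℂ) * ((Real.exp (-2 * K * t) *
        (G.heat t (fun y => (ρ y : ℂ)) x).re : ℝ) : ℂ) * G.vecGamma ξ ξ x := by
    have := congrArg (fun z => (Real.exp (-2 * K * t) : ℂ) * z)
      (G.sum_heat_mul t (fun y => (ρ y : ℂ)) (G.vecGamma ξ ξ))
    simp only [Finset.mul_sum] at this
    convert this.symm using 2 with x _ x _
    · ring
    · rw [Complex.ofReal_mul, (G.heat_ofReal_nonneg ht hρ x).2]
      ring
  rw [h2, sum_vecGamma G (fun x => (ρ x : ℂ)), sum_vecGamma G (fun x =>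
    ((Real.exp (-2 * K * t) * (G.heat t (fun y => (ρ y : ℂ)) x).re : ℝ) : ℂ))] at h1
  exact_mod_cast h1

open Classical in
-- Apply the left bound to `𝒥ξ` and relabel the sums by edge reversal, which preserves `b`.
theorem sum_edge_right_le {t : ℝ} (ht : 0 ≤ t) {V : G.EdgeFun →ₗ[ℂ] G.EdgeFun}
    (hJ : ∀ ξ : G.EdgeFun, V (G.conjJ ξ) = G.conjJ (V ξ))
    (hV : ∀ ξ : G.EdgeFun, ∀ x : X, G.vecGamma (V ξ) (V ξ) x ≤
      (Real.exp (-2 * K * t) : ℂ) * G.heat t (G.vecGamma ξ ξ) x)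
    {ρ : X → ℝ} (hρ : ∀ x, 0 ≤ ρ x) (ξ : G.EdgeFun) :
    ∑ e : G.Edge, G.b e.1.1 e.1.2 / 2 * ρ e.1.2 * ‖V ξ e‖ ^ 2 ≤
      ∑ e : G.Edge, G.b e.1.1 e.1.2 / 2 *
        (Real.exp (-2 * K * t) * (G.heat t (fun y => (ρ y : ℂ)) e.1.2).re) * ‖ξ e‖ ^ 2 := by
  have hnorm : ∀ (η : G.EdgeFun) (e : G.Edge), ‖G.conjJ η e‖ = ‖η e.swap‖ := by
    intro η e
    simp [conjJ]
  have h := sum_edge_left_le ht hV hρ (G.conjJ ξ)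
  rw [hJ, ← sum_edge_swap, ← sum_edge_swap (F := fun e : G.Edge => G.b e.1.1 e.1.2 / 2 *
    (Real.exp (-2 * K * t) * (G.heat t (fun y => (ρ y : ℂ)) e.1.1).re) *
      ‖G.conjJ ξ e‖ ^ 2)] at h
  simp only [hnorm] at h
  have hb : ∀ e : G.Edge, G.b e.swap.1.1 e.swap.1.2 = G.b e.1.1 e.1.2 := fun e => G.b_symm _ _
  simp only [hb] at h
  exact h

end FiniteWeightedGraph

/-! ### Arithmetic, geometric and logarithmic means -/

theorem IsOperatorMean.exists_monotone_continuousOn {Λ : ℝ → ℝ → ℝ} (hΛ : IsOperatorMean Λ) :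
    ∃ h : ℝ → ℝ, (∀ r, 0 < r → 0 < h r) ∧ OperatorMonotone h ∧ ContinuousOn h (Set.Ioi 0) ∧
      ∀ s t, 0 < s → 0 < t → Λ s t = s * h (t / s) := by
  obtain ⟨h, hpos, hmono, -, hrep⟩ := hΛ.exists_monotone
  refine ⟨h, hpos, hmono, ?_, hrep⟩
  have h1 : ContinuousOn (fun r : ℝ => Λ 1 r) (Set.Ioi 0) :=
    hΛ.continuousOn.comp (f := fun r : ℝ => ((1 : ℝ), r)) (by fun_prop)
      fun r hr => ⟨Set.mem_Ici.2 zero_le_one, Set.mem_Ici.2 (le_of_lt hr)⟩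
  refine h1.congr fun r hr => ?_
  simp [hrep 1 r one_pos hr]

theorem isOperatorMean_arithmeticMean : IsOperatorMean arithmeticMean where
  nonneg s t hs ht := by unfold arithmeticMean; positivity
  continuousOn := by unfold arithmeticMean; fun_prop
  exists_monotone := by
    refine ⟨fun r => (1 + r) / 2, fun r hr => by positivity, ?_, by norm_num, fun s t hs _ => ?_⟩
    · intro n A B hA hB hAB
      have h1 : ∀ C : Matrix (Fin n) (Fin n) ℂ, C.IsHermitian →
          cfc (fun r : ℝ => (1 + r) / 2) C = (1 / 2 : ℝ) • (1 + C) := by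
        intro C hC
        have h2 : (fun r : ℝ => (1 + r) / 2) =
            (Polynomial.C (1 / 2 : ℝ) * (1 + Polynomial.X)).eval := by
          funext r
          simp
          ring
        rw [h2, cfc_polynomial _ C hC.isSelfAdjoint]
        simp [Algebra.algebraMap_eq_smul_one]
      rw [h1 A hA.1, h1 B hB.1, ← smul_sub, add_sub_add_left_eq_sub]
      exact hAB.smul (by norm_num)
    · unfold arithmeticMean
      field_simp

open scoped MatrixOrder Matrix.Norms.L2Operator in
/-- The Löwner–Heinz inequality for positive definite matrices. -/
theorem operatorMonotone_rpow {θ : ℝ} (hθ : θ ∈ Set.Icc 0 1) :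
    OperatorMonotone fun r => r ^ θ := by
  intro n A B hA hB hAB
  have h := CFC.rpow_le_rpow hθ (Matrix.le_iff.2 hAB)
  rw [CFC.rpow_eq_cfc_real (Matrix.nonneg_iff_posSemidef.2 hA.posSemidef),
    CFC.rpow_eq_cfc_real (Matrix.nonneg_iff_posSemidef.2 hB.posSemidef)] at h
  exact Matrix.le_iff.1 h

/-- The weighted geometric means are operator means. -/
theorem isOperatorMean_geometric {θ : ℝ} (hθ : θ ∈ Set.Ioo 0 1) :
    IsOperatorMean fun s t => s ^ (1 - θ) * t ^ θ where
  nonneg s t hs ht := by positivity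
  continuousOn := by
    refine ContinuousOn.mul ?_ ?_
    · exact continuousOn_fst.rpow_const fun _ _ => Or.inr (by linarith [hθ.2])
    · exact continuousOn_snd.rpow_const fun _ _ => Or.inr hθ.1.le
  exists_monotone := by
    refine ⟨fun r => r ^ θ, fun r hr => by positivity,
      operatorMonotone_rpow ⟨hθ.1.le, hθ.2.le⟩, by simp, fun s t hs ht => ?_⟩
    simp only [Real.rpow_sub hs, Real.rpow_one, Real.div_rpow ht.le hs.le]
    ring

/-- The endpoints must be excluded because `0 ^ 0 = 1`; they do not affect the integral. -/
theorem geometric_eq_zero {s t : ℝ} (hs : 0 ≤ s) (ht : 0 ≤ t) (h : ¬(0 < s ∧ 0 < t)) :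
    Set.EqOn (fun _ => 0) (fun θ : ℝ => s ^ (1 - θ) * t ^ θ) (Set.uIoo 0 1) := by
  intro θ hθ
  rw [Set.uIoo_of_le zero_le_one] at hθ
  rcases hs.eq_or_lt with rfl | hs
  · simp [Real.zero_rpow (sub_pos.2 hθ.2).ne']
  · have ht0 : t = 0 := le_antisymm (not_lt.1 fun h' => h ⟨hs, h'⟩) ht
    simp [ht0, Real.zero_rpow hθ.1.ne']

theorem intervalIntegrable_geometric {s t : ℝ} (hs : 0 ≤ s) (ht : 0 ≤ t) :
    IntervalIntegrable (fun θ => s ^ (1 - θ) * t ^ θ) MeasureTheory.volume 0 1 := by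
  by_cases h : 0 < s ∧ 0 < t
  · refine Continuous.intervalIntegrable ?_ _ _
    have h1 : Continuous fun θ : ℝ => s ^ (1 - θ) :=
      (continuous_const (y := s)).rpow (by fun_prop) fun _ => Or.inl h.1.ne'
    have h2 : Continuous fun θ : ℝ => t ^ θ :=
      (continuous_const (y := t)).rpow (by fun_prop) fun _ => Or.inl h.2.ne'
    exact h1.mul h2
  · exact (intervalIntegrable_const (c := (0 : ℝ))).congr_uIoo (geometric_eq_zero hs ht h)

theorem integral_geometric {s t : ℝ} (hs : 0 ≤ s) (ht : 0 ≤ t) :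
    ∫ θ in (0 : ℝ)..1, s ^ (1 - θ) * t ^ θ = logarithmicMean s t := by
  unfold logarithmicMean
  split_ifs with h hst
  · subst hst
    have : ∀ θ : ℝ, s ^ (1 - θ) * s ^ θ = s := fun θ => by
      rw [← Real.rpow_add h.1]; simp
    simp [this]
  · have hlog : Real.log t - Real.log s ≠ 0 := by
      rw [sub_ne_zero]
      exact fun h' => hst (Real.log_injOn_pos h.2 h.1 h').symm
    have h1 : ∀ θ : ℝ, s ^ (1 - θ) * t ^ θ = s * Real.exp (θ * (Real.log t - Real.log s)) := by
      intro θ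
      rw [Real.rpow_def_of_pos h.1, Real.rpow_def_of_pos h.2, ← Real.exp_add]
      conv_rhs => rw [← Real.exp_log h.1, ← Real.exp_add, Real.log_exp]
      congr 1
      ring
    simp only [h1]
    rw [intervalIntegral.integral_const_mul, intervalIntegral.integral_comp_mul_right _ hlog,
      integral_exp, zero_mul, one_mul, Real.exp_sub, Real.exp_log h.1, Real.exp_log h.2,
      Real.exp_zero, smul_eq_mul]
    have hlog' : Real.log s - Real.log t ≠ 0 := by
      rw [← neg_sub]; exact neg_ne_zero.2 hlog
    have := h.1.ne'
    rw [show Real.log s - Real.log t = -(Real.log t - Real.log s) by ring]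
    field_simp
    ring
  · rw [← intervalIntegral.integral_congr_uIoo (geometric_eq_zero hs ht h)]
    simp

/-! ### Gradient estimates -/

namespace FiniteWeightedGraph

variable {X : Type*} [Fintype X] {G : FiniteWeightedGraph X} {K : ℝ}

open Classical in
theorem gradientEstimate_iff {Λ : ℝ → ℝ → ℝ} : G.GradientEstimate Λ K ↔
    ∀ (f : X → ℂ) (ρ : X → ℝ) (t : ℝ), (∀ x, 0 ≤ ρ x) → 0 ≤ t →
      ∑ e : G.Edge, G.b e.1.1 e.1.2 / 2 * Λ (ρ e.1.1) (ρ e.1.2) * ‖G.grad (G.heat t f) e‖ ^ 2 ≤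
        Real.exp (-2 * K * t) * ∑ e : G.Edge, G.b e.1.1 e.1.2 / 2 *
          Λ (G.heat t (fun y => (ρ y : ℂ)) e.1.1).re (G.heat t (fun y => (ρ y : ℂ)) e.1.2).re *
            ‖G.grad f e‖ ^ 2 := by
  unfold GradientEstimate
  refine forall_congr' fun f => forall_congr' fun ρ => forall_congr' fun t =>
    imp_congr_right fun _ => imp_congr_right fun _ => ?_
  rw [weightedEnergy_eq, weightedEnergy_eq, ← Complex.ofReal_mul, Complex.real_le_real]

open Classical in
theorem IntertwiningCurvatureBound.gradientEstimate (hK : G.IntertwiningCurvatureBound K)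
    {Λ : ℝ → ℝ → ℝ} (hΛ : IsOperatorMean Λ) : G.GradientEstimate Λ K := by
  obtain ⟨V, -, hgrad, hJ, hV⟩ := hK
  obtain ⟨h, hpos, hmono, hcont, hrep⟩ := hΛ.exists_monotone_continuousOn
  rw [gradientEstimate_iff]
  intro f ρ t hρ ht
  set P : X → ℝ := fun x => (G.heat t (fun y => (ρ y : ℂ)) x).re with hP
  have hP0 : ∀ x, 0 ≤ P x := fun x => (G.heat_ofReal_nonneg ht hρ x).1
  set c := Real.exp (-2 * K * t) with hc
  have hc0 : 0 < c := Real.exp_pos _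
  -- The formula `Λ(s,t) = s h(t/s)` needs positive arguments, so `ρ` is replaced by `ρ + ε`.
  -- Constants are fixed by `P_t`, so `P_tρ` is shifted by the same `ε`; continuity of `Λ` then
  -- permits `ε → 0`.
  have hpert : ∀ ε : ℝ, 0 < ε →
      ∑ e : G.Edge, G.b e.1.1 e.1.2 / 2 * Λ (ρ e.1.1 + ε) (ρ e.1.2 + ε) *
        ‖G.grad (G.heat t f) e‖ ^ 2 ≤
      c * ∑ e : G.Edge, G.b e.1.1 e.1.2 / 2 * Λ (P e.1.1 + ε) (P e.1.2 + ε) *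
        ‖G.grad f e‖ ^ 2 := by
    intro ε hε
    have hρε : ∀ x, 0 < ρ x + ε := fun x => by linarith [hρ x]
    have hPε : ∀ x, 0 < P x + ε := fun x => by linarith [hP0 x]
    have hl := sum_edge_left_le ht (hV t ht) fun x => (hρε x).le
    have hr := sum_edge_right_le ht (hJ t ht) (hV t ht) fun x => (hρε x).le
    simp only [heat_add_const] at hl hr
    have key := hmono.mean_le hpos hcont (V t) (w := fun e : G.Edge => G.b e.1.1 e.1.2 / 2)
      (a := fun e => ρ e.1.1 + ε) (b := fun e => ρ e.1.2 + ε)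
      (a' := fun e => c * (P e.1.1 + ε)) (b' := fun e => c * (P e.1.2 + ε))
      (fun e => half_pos e.2) (fun e => hρε _) (fun e => hρε _)
      (fun e => mul_pos hc0 (hPε _)) (fun e => mul_pos hc0 (hPε _)) hl hr (G.grad f)
    rw [hgrad t ht, Finset.mul_sum]
    convert key using 2 with e _ e _
    · rw [hrep _ _ (hρε _) (hρε _)]
    -- Homogeneity: `c` cancels in the quotient and survives once as a prefactor.
    · rw [hrep _ _ (hPε _) (hPε _), mul_div_mul_left _ _ hc0.ne']
      ring
  have hlim : ∀ (σ : X → ℝ) (g : G.EdgeFun), (∀ x, 0 ≤ σ x) → Filter.Tendsto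
      (fun ε : ℝ => ∑ e : G.Edge, G.b e.1.1 e.1.2 / 2 * Λ (σ e.1.1 + ε) (σ e.1.2 + ε) *
        ‖g e‖ ^ 2) (nhdsWithin 0 (Set.Ioi 0))
      (nhds (∑ e : G.Edge, G.b e.1.1 e.1.2 / 2 * Λ (σ e.1.1) (σ e.1.2) * ‖g e‖ ^ 2)) := by
    intro σ g hσ
    refine tendsto_finsetSum _ fun e _ => Filter.Tendsto.mul_const _ (Filter.Tendsto.const_mul _ ?_)
    have h1 := hΛ.continuousOn (σ e.1.1, σ e.1.2) ⟨hσ _, hσ _⟩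
    refine h1.tendsto.comp (f := fun ε : ℝ => (σ e.1.1 + ε, σ e.1.2 + ε))
      (tendsto_nhdsWithin_iff.2 ⟨?_, ?_⟩)
    · have : Continuous fun ε : ℝ => (σ e.1.1 + ε, σ e.1.2 + ε) := by fun_prop
      have h2 := this.tendsto 0
      simp only [add_zero] at h2
      exact h2.mono_left nhdsWithin_le_nhds
    · refine eventually_nhdsWithin_of_forall fun ε hε => ?_
      exact ⟨add_nonneg (hσ _) (le_of_lt hε), add_nonneg (hσ _) (le_of_lt hε)⟩
  exact le_of_tendsto_of_tendsto (hlim ρ _ hρ) ((hlim P _ hP0).const_mul c)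
    (eventually_nhdsWithin_of_forall hpert)

open Classical in
-- Both sides of the estimate are linear in `Λ`, so it is preserved under averaging over `θ`.
theorem gradientEstimate_logarithmicMean
    (h : ∀ θ ∈ Set.Ioo (0 : ℝ) 1, G.GradientEstimate (fun s t => s ^ (1 - θ) * t ^ θ) K) :
    G.GradientEstimate logarithmicMean K := by
  rw [gradientEstimate_iff]
  intro f ρ t hρ ht
  have hP0 : ∀ x, 0 ≤ (G.heat t (fun y => (ρ y : ℂ)) x).re :=
    fun x => (G.heat_ofReal_nonneg ht hρ x).1
  have hint : ∀ (σ : X → ℝ) (g : G.EdgeFun), (∀ x, 0 ≤ σ x) → ∀ e ∈ Finset.univ,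
      IntervalIntegrable (fun θ : ℝ => G.b e.1.1 e.1.2 / 2 * (σ e.1.1 ^ (1 - θ) * σ e.1.2 ^ θ) *
        ‖g e‖ ^ 2) MeasureTheory.volume 0 1 := fun σ g hσ e _ =>
    ((intervalIntegrable_geometric (hσ _) (hσ _)).const_mul _).mul_const _
  have hsum : ∀ (σ : X → ℝ) (g : G.EdgeFun), (∀ x, 0 ≤ σ x) →
      IntervalIntegrable (fun θ : ℝ => ∑ e : G.Edge, G.b e.1.1 e.1.2 / 2 *
        (σ e.1.1 ^ (1 - θ) * σ e.1.2 ^ θ) * ‖g e‖ ^ 2) MeasureTheory.volume 0 1 := by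
    intro σ g hσ
    simpa only [Finset.sum_fn] using IntervalIntegrable.sum _ (hint σ g hσ)
  have heq : ∀ (σ : X → ℝ) (g : G.EdgeFun), (∀ x, 0 ≤ σ x) →
      ∑ e : G.Edge, G.b e.1.1 e.1.2 / 2 * logarithmicMean (σ e.1.1) (σ e.1.2) * ‖g e‖ ^ 2 =
      ∫ θ in (0 : ℝ)..1, ∑ e : G.Edge, G.b e.1.1 e.1.2 / 2 *
        (σ e.1.1 ^ (1 - θ) * σ e.1.2 ^ θ) * ‖g e‖ ^ 2 := by
    intro σ g hσ
    rw [intervalIntegral.integral_finsetSum (hint σ g hσ)]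
    refine Finset.sum_congr rfl fun e _ => ?_
    rw [intervalIntegral.integral_mul_const, intervalIntegral.integral_const_mul,
      integral_geometric (hσ _) (hσ _)]
  rw [heq ρ _ hρ, heq (fun x => (G.heat t (fun y => (ρ y : ℂ)) x).re) _ hP0,
    ← intervalIntegral.integral_const_mul]
  refine intervalIntegral.integral_mono_on_of_le_Ioo zero_le_one
    (hsum ρ _ hρ) ((hsum (fun x => (G.heat t (fun y => (ρ y : ℂ)) x).re) _ hP0).const_mul _)
    fun θ hθ => ?_
  exact gradientEstimate_iff.1 (h θ hθ) f ρ t hρ ht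

end FiniteWeightedGraph

theorem mainTheorem1 {X : Type*} [Fintype X] (G : FiniteWeightedGraph X) (K : ℝ)
    (hK : G.IntertwiningCurvatureBound K) :
    (∀ Λ : ℝ → ℝ → ℝ, IsOperatorMean Λ → G.GradientEstimate Λ K) ∧
    G.GradientEstimate arithmeticMean K ∧ G.BakryEmeryBound K ∧
    G.GradientEstimate logarithmicMean K :=
  ⟨fun _ hΛ => hK.gradientEstimate hΛ, hK.gradientEstimate isOperatorMean_arithmeticMean,
    hK.bakryEmeryBound, FiniteWeightedGraph.gradientEstimate_logarithmicMean fun _ hθ =>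
      hK.gradientEstimate (isOperatorMean_geometric hθ)⟩
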